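/- For a finite set $X\subset\mathbb{R}^d$ of points with rational coordinates and an integer $k$, a $k$-clustering of $X$ is a partition of $X$ into $k$ nonempty clusters $C_1,\dots,C_k$; its centers are the means $\mu_j=\frac1{|C_j|}\sum_{x\in C_j}x$ and its cost is $\sum_{j=1}^k\sum_{x\in C_j}\|x-\mu_j\|^2$ (Euclidean norm). It is $\alpha$-center proximal if $\|x-\mu_j\|>\alpha\|x-\mu_i\|$ for all $i\neq j$ and all $x\in C_i$, and $\omega$-balanced if $|C_j|\ge \omega|X|/k$ for every $j$. Theorem. There is an absolute constant $c>0$ such that for every degree bound $\Delta$ there are constants $\alpha>1$ and $\omega>0$ and a polynomial-time computable map that sends every Vertex Cover instance $(G,k)$ to a Euclidean $k$-means instance $(X,k)$ with the same $k$, such that the following holds whenever $G$ is triangle-free with maximum degree at most $\Delta$; let $m$ be the number of edges of $G$. (i) If $k\le m$ and $G$ has a vertex cover with at most $k$ vertices (in particular, if the minimum size of a vertex cover of $G$ is $k$), then $X$ has an $\alpha$-center proximal, $\omega$-balanced $k$-clustering of cost at most $m-k$. (ii) For every $\varepsilon>0$: if every vertex cover of $G$ has size at least $k(1+\varepsilon)$,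 then every $\alpha$-center proximal, $\omega$-balanced $k$-clustering of $X$ has cost at least $m-(1-c\,\varepsilon)k$. -/

import Mathlib

/-! ### Instances of Vertex Cover -/

/-- An instance of Vertex Cover: a simple graph on the vertices `0, …, n - 1` and a number `k`. -/
structure VertexCoverInstance where
  n : ℕ
  graph : SimpleGraph (Fin n)
  k : ℕ

/-- The list of the edges of a graph, each edge `{i, j}` being listed once, as the pair `(i, j)`
with `i < j`, in lexicographic order. -/
noncomputable def edgePairs {n : ℕ} (G : SimpleGraph (Fin n)) : List (Fin n × Fin n) :=
  open scoped Classical in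
  (List.finRange n ×ˢ List.finRange n).filter (fun p => p.1 < p.2 ∧ G.Adj p.1 p.2)

/-! ### Instances of Euclidean `k`-means and their clusterings -/

/-- An instance of Euclidean `k`-means: a finite set of points of `ℝ^d` with rational coordinates,
given as a list without repetitions, and a number `k` of clusters. -/
structure KMeansInstance where
  d : ℕ
  points : List (Fin d → ℚ)
  nodup : points.Nodup
  k : ℕ

/-- The `i`-th point of an instance, as a point of Euclidean space. -/
noncomputable def KMeansInstance.point (K : KMeansInstance) (i : Fin K.points.length) :
    EuclideanSpace ℝ (Fin K.d) :=
  WithLp.toLp 2 (fun t => ((K.points.get i t : ℚ) : ℝ))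

/-- A `k`-clustering of an instance: a partition of its points into `k` nonempty clusters
`C_j = {i | assign i = j}`. -/
structure KClustering (K : KMeansInstance) where
  assign : Fin K.points.length → Fin K.k
  nonempty : Function.Surjective assign

namespace KClustering

variable {K : KMeansInstance}

/-- The cluster `C_j`, as a set of indices of points. -/
def cluster (C : KClustering K) (j : Fin K.k) : Finset (Fin K.points.length) :=
  Finset.univ.filter (fun i => C.assign i = j)

/-- The center of the cluster `C_j`: its mean. -/
noncomputable def mean (C : KClustering K) (j : Fin K.k) : EuclideanSpace ℝ (Fin K.d) :=
  ((C.cluster j).card : ℝ)⁻¹ • ∑ i ∈ C.cluster j, K.point i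

/-- The `k`-means cost: the sum of the squared distances of the points to the centers of their
clusters. -/
noncomputable def cost (C : KClustering K) : ℝ :=
  ∑ j : Fin K.k, ∑ i ∈ C.cluster j, dist (K.point i) (C.mean j) ^ 2

/-- `α`-center proximity. -/
def CenterProximal (C : KClustering K) (α : ℝ) : Prop :=
  ∀ i j : Fin K.k, i ≠ j → ∀ x ∈ C.cluster i,
    α * dist (K.point x) (C.mean i) < dist (K.point x) (C.mean j)

/-- Every cluster has at least `ω n / k` points, where `n` is the number of points. -/
def Balanced (C : KClustering K) (ω : ℝ) : Prop :=
  ∀ j : Fin K.k, ω * (K.points.length : ℝ) / (K.k : ℝ) ≤ ((C.cluster j).card : ℝ)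

end KClustering

/-! ### Encodings as words over the alphabet `Γ'` (`blank`, two bits, `bra`, `ket`, `comma`) -/

/-- Numbers in unary. -/
def unaryWord (n : ℕ) : List Computability.Γ' :=
  List.replicate n (Computability.Γ'.bit true)

/-- Numbers in binary. -/
def binaryWord (n : ℕ) : List Computability.Γ' :=
  (Computability.encodeNat n).map Computability.Γ'.bit

/-- A rational number: sign, numerator and denominator (in lowest terms, in binary). -/
def rationalWord (q : ℚ) : List Computability.Γ' :=
  Computability.Γ'.bit (decide (q < 0)) :: binaryWord q.num.natAbs ++
    Computability.Γ'.blank :: binaryWord q.den ++ [Computability.Γ'.comma]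

/-- A point: the list of its coordinates. -/
def pointWord {d : ℕ} (x : Fin d → ℚ) : List Computability.Γ' :=
  Computability.Γ'.bra :: (List.ofFn x).flatMap rationalWord ++ [Computability.Γ'.ket]

/-- An edge: its two endpoints. -/
def edgeWord {n : ℕ} (e : Fin n × Fin n) : List Computability.Γ' :=
  Computability.Γ'.bra :: unaryWord e.1 ++ Computability.Γ'.comma :: unaryWord e.2 ++
    [Computability.Γ'.ket]

/-- A Vertex Cover instance: the number of vertices, the list of edges and, in binary, `k`. The
number of vertices and the names of the vertices are in unary, so that the length of the word is
polynomially related to the number of vertices plus the number of edges plus the length of `k`. -/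
noncomputable def VertexCoverInstance.encode (I : VertexCoverInstance) : List Computability.Γ' :=
  unaryWord I.n ++ Computability.Γ'.comma :: (edgePairs I.graph).flatMap edgeWord ++
    Computability.Γ'.blank :: binaryWord I.k

/-- A `k`-means instance: the dimension (in unary), the list of points and, in binary, `k`. -/
def KMeansInstance.encode (K : KMeansInstance) : List Computability.Γ' :=
  unaryWord K.d ++ Computability.Γ'.comma :: K.points.flatMap pointWord ++
    Computability.Γ'.blank :: binaryWord K.k

/-- A map from Vertex Cover instances to `k`-means instances is efficiently computable if some
Turing machine computes it, on encodings, in a number of steps that is bounded by a polynomial in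
the length of the input. -/
def EfficientlyComputable (f : VertexCoverInstance → KMeansInstance) : Prop :=
  Nonempty (Turing.TM2ComputableInPolyTime VertexCoverInstance.encode KMeansInstance.encode f)

/-! ### The reduction -/

/-! The reduction sends the edge {i, j} to e_i + e_j. Two distinct edges are at squared distance 2
if they meet and 4 if they are disjoint. Since the cost of a cluster depends only on pairwise
distances, a cluster F costs |F| - 1 + D(F), where D(F) is the average over x in F of the number of
edges of F disjoint from x. Summing, cost = m - k + ∑ D(C_j) (`cost_eq`).

A vertex cover of size at most k groups the edges into at most k stars, refined to exactly k
(`exists_surjective_refinement`). Stars have D = 0. The points of a star with s edges lie at squared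
distance 1 - 1/s from its center and all other points at least at 1 + 1/s. Bounded degree bounds s,
which gives center proximity and balance (`exists_clustering`).

Conversely, in a triangle-free graph the edges of a cluster F are covered by at most 1 + 3 D(F)
vertices (`exists_cover_card_le`). The union of these covers has size at most k + 3 (cost - (m -
k)), so covers of size at least k(1 + ε) force an excess of at least εk/3.

Polynomial time is shown by an explicit stack machine that writes the incidence vectors edge by edge
(`runsIn_program`). -/

/-- The point `e_i + e_j` that represents the edge `{i, j}`. -/
def edgePoint {n : ℕ} (e : Fin n × Fin n) : Fin n → ℚ :=
  fun t => if t = e.1 ∨ t = e.2 then 1 else 0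

/-! ### The word that represents an edge point -/

theorem rationalWord_zero : rationalWord 0 =
    [Computability.Γ'.bit false, Computability.Γ'.blank, Computability.Γ'.bit true,
      Computability.Γ'.comma] := rfl

theorem rationalWord_one : rationalWord 1 =
    [Computability.Γ'.bit false, Computability.Γ'.bit true, Computability.Γ'.blank,
      Computability.Γ'.bit true, Computability.Γ'.comma] := rfl

/-- The word of a list of `n` zero coordinates. -/
def zerosWord (n : ℕ) : List Computability.Γ' :=
  (List.replicate n (0 : ℚ)).flatMap rationalWord

theorem zerosWord_succ (n : ℕ) : zerosWord (n + 1) = rationalWord 0 ++ zerosWord n := rfl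

theorem length_zerosWord (n : ℕ) : (zerosWord n).length = 4 * n := by
  induction n with
  | zero => rfl
  | succ n ih => rw [zerosWord_succ, List.length_append, ih, rationalWord_zero]; simp; omega

theorem ofFn_edgePoint {n : ℕ} (e : Fin n × Fin n) (h : e.1 < e.2) :
    List.ofFn (edgePoint e) = List.replicate e.1 (0 : ℚ) ++ 1 ::
      (List.replicate (e.2 - e.1 - 1) (0 : ℚ) ++ 1 :: List.replicate (n - e.2 - 1) (0 : ℚ)) := by
  obtain ⟨⟨i, hi⟩, ⟨j, hj⟩⟩ := e
  simp only [Fin.mk_lt_mk] at h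
  apply List.ext_getElem
  · simp; omega
  · intro t h₁ h₂
    simp only [List.getElem_ofFn, edgePoint, Fin.mk.injEq, List.getElem_append,
      List.length_replicate, List.getElem_replicate, List.getElem_cons]
    split_ifs <;> first | rfl | omega

theorem pointWord_edgePoint {n : ℕ} (e : Fin n × Fin n) (h : e.1 < e.2) :
    pointWord (edgePoint e) = Computability.Γ'.bra :: (zerosWord e.1 ++ (rationalWord 1 ++
      (zerosWord (e.2 - e.1 - 1) ++ (rationalWord 1 ++ (zerosWord (n - e.2 - 1) ++
        [Computability.Γ'.ket]))))) := by
  simp [pointWord, ofFn_edgePoint e h, zerosWord, List.append_assoc]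

theorem length_pointWord_edgePoint {n : ℕ} (e : Fin n × Fin n) (h : e.1 < e.2) :
    (pointWord (edgePoint e)).length = 4 * n + 4 := by
  rw [pointWord_edgePoint e h]
  have := e.2.isLt
  have : (e.1 : ℕ) < e.2 := h
  simp only [List.length_cons, List.length_append, length_zerosWord, rationalWord_one,
    List.length_nil]
  omega

/-! ### A stack machine for the reduction -/

namespace ReductionMachine

open Computability Turing Turing.TM2.Stmt

/-- The contents: the input, three unary counters, the reversed output, and the output. -/
inductive Stack
  | inp | todo | done₁ | done₂ | rev | out
  deriving DecidableEq

instance : Fintype Stack :=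
  ⟨{.inp, .todo, .done₁, .done₂, .rev, .out}, fun x => by cases x <;> decide⟩

/-- The labels of the program. -/
inductive Label
  | header | edges | first | second | skip | fill | restore | tail | clear | flush
  deriving DecidableEq

instance : Fintype Label :=
  ⟨{.header, .edges, .first, .second, .skip, .fill, .restore, .tail, .clear, .flush},
    fun x => by cases x <;> decide⟩

/-- The statements of the machine. -/
abbrev Statement := TM2.Stmt (fun _ : Stack => Γ') Label (Option Γ')

/-- Append a word to the reversed output. -/
def emit : List Γ' → Statement → Statement
  | [], q => q
  | x :: w, q => push .rev (fun _ => x) (emit w q)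

/-- Whether the symbol that was read last is a bit. -/
def isBit : Option Γ' → Bool
  | some (Γ'.bit _) => true
  | _ => false

/-- Read a symbol. -/
def read (k : Stack) (q : Statement) : Statement := pop k (fun _ x => x) q

/-- Forget the last symbol and go to a label. -/
def next (l : Label) : Statement := load (fun _ => none) (goto fun _ => l)

/-- Move one unit from a counter to another one, without looking at it. -/
def move (k l : Stack) (q : Statement) : Statement :=
  pop k (fun v _ => v) (push l (fun _ => Γ'.bit true) q)

/-- The program. While an edge `{i, j}` of a graph with `n` vertices is read, `todo` counts the
coordinates that have not been written yet. -/
def program : Label → Statement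
  | .header => read .inp <| branch isBit
      (push .todo (fun _ => Γ'.bit true) <| emit [Γ'.bit true] <| next .header)
      (emit [Γ'.comma] <| next .edges)
  | .edges => read .inp <| branch (fun v => v = some Γ'.bra)
      (emit [Γ'.bra] <| next .first)
      (emit [Γ'.blank] <| next .tail)
  | .first => read .inp <| branch isBit
      (move .todo .done₁ <| emit (rationalWord 0) <| next .first)
      (move .todo .done₁ <| emit (rationalWord 1) <| next .second)
  | .second => read .inp <| branch isBit
      (next .skip)
      (move .todo .done₂ <| emit (rationalWord 1) <| next .fill)
  -- After `.first`, `done₁` holds i + 1 units. The first i + 1 units of j only use these up, as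
  -- coordinates 0, …, i are already written; each of the other j - i - 1 units writes a zero.
  | .skip => read .done₁ <| branch isBit
      (push .done₂ (fun _ => Γ'.bit true) <| next .second)
      (move .todo .done₂ <| emit (rationalWord 0) <| next .second)
  | .fill => read .todo <| branch isBit
      (push .done₂ (fun _ => Γ'.bit true) <| emit (rationalWord 0) <| next .fill)
      (emit [Γ'.ket] <| next .restore)
  | .restore => read .done₂ <| branch isBit
      (push .todo (fun _ => Γ'.bit true) <| next .restore)
      (next .edges)
  | .tail => read .inp <| branch Option.isSome
      (push .rev (fun v => v.getD Γ'.blank) <| next .tail)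
      (next .clear)
  | .clear => read .todo <| branch Option.isSome
      (next .clear)
      (next .flush)
  | .flush => read .rev <| branch Option.isSome
      (push .out (fun v => v.getD Γ'.blank) <| next .flush)
      halt

/-- The bundled machine. -/
def machine : FinTM2 where
  K := Stack
  k₀ := .inp
  k₁ := .out
  Γ := fun _ => Γ'
  Λ := Label
  main := .header
  σ := Option Γ'
  initialState := none
  m := program

/-- The contents of the stacks; `r` is the word written so far, in the right order. -/
def contents (i a b c r o : List Γ') : Stack → List Γ'
  | .inp => i
  | .todo => a
  | .done₁ => b
  | .done₂ => c
  | .rev => r.reverse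
  | .out => o

section contents
variable (i a b c r o x : List Γ') (s : Γ')

@[simp] theorem update_inp :
    Function.update (contents i a b c r o) .inp x = contents x a b c r o := by
  funext k; cases k <;> rfl
@[simp] theorem update_todo :
    Function.update (contents i a b c r o) .todo x = contents i x b c r o := by
  funext k; cases k <;> rfl
@[simp] theorem update_done₁ :
    Function.update (contents i a b c r o) .done₁ x = contents i a x c r o := by
  funext k; cases k <;> rfl
@[simp] theorem update_done₂ :
    Function.update (contents i a b c r o) .done₂ x = contents i a b x r o := by
  funext k; cases k <;> rfl
@[simp] theorem update_rev :
    Function.update (contents i a b c r o) .rev x = contents i a b c x.reverse o := by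
  funext k; cases k <;> simp [contents]
@[simp] theorem update_out :
    Function.update (contents i a b c r o) .out x = contents i a b c r x := by
  funext k; cases k <;> rfl
@[simp] theorem contents_inp : contents i a b c r o .inp = i := rfl
@[simp] theorem contents_todo : contents i a b c r o .todo = a := rfl
@[simp] theorem contents_done₁ : contents i a b c r o .done₁ = b := rfl
@[simp] theorem contents_done₂ : contents i a b c r o .done₂ = c := rfl
@[simp] theorem contents_rev : contents i a b c r o .rev = r.reverse := rfl
@[simp] theorem contents_out : contents i a b c r o .out = o := rfl

@[simp] theorem stepAux_emit (w : List Γ') (q : Statement) (v : Option Γ') :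
    TM2.stepAux (emit w q) v (contents i a b c r o) =
      TM2.stepAux q v (contents i a b c (r ++ w) o) := by
  induction w generalizing r with
  | nil => simp [emit]
  | cons x w ih => simp [emit, ih]

end contents

/-- The configuration with label `l`, no symbol in memory, and the given stacks. -/
def cfg (l : Label) (i a b c r o : List Γ') :
    TM2.Cfg (fun _ : Stack => Γ') Label (Option Γ') :=
  ⟨some l, none, contents i a b c r o⟩

/-- The machine gets from `x` to `y` in exactly `t` steps. -/
def RunsIn (t : ℕ) (x y : TM2.Cfg (fun _ : Stack => Γ') Label (Option Γ')) : Prop :=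
  (flip bind (TM2.step program))^[t] (some x) = some y

theorem RunsIn.refl (x) : RunsIn 0 x x := rfl

theorem RunsIn.trans {s t : ℕ} {x y z} (h₁ : RunsIn s x y) (h₂ : RunsIn t y z) :
    RunsIn (s + t) x z := by
  unfold RunsIn at *
  rw [Nat.add_comm, Function.iterate_add_apply, h₁, h₂]

theorem RunsIn.step {x y} (h : TM2.step program x = some y) : RunsIn 1 x y := h

theorem RunsIn.head {t : ℕ} {x y z} (h₁ : TM2.step program x = some y) (h₂ : RunsIn t y z) :
    RunsIn (t + 1) x z := by
  rw [Nat.add_comm]; exact (RunsIn.step h₁).trans h₂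

theorem RunsIn.congr {t : ℕ} {x x' y y'} (h : RunsIn t x y) (hx : x = x') (hy : y = y') :
    RunsIn t x' y' := hx ▸ hy ▸ h

theorem unaryWord_succ (n : ℕ) : unaryWord (n + 1) = Γ'.bit true :: unaryWord n := rfl

/-! ### Single steps of the machine -/

section steps
variable (i a b c r o : List Γ')

theorem step_header_bit (s : Bool) : TM2.step program (cfg .header (Γ'.bit s :: i) a b c r o) =
    some (cfg .header i (Γ'.bit true :: a) b c (r ++ [Γ'.bit true]) o) := by
  simp [cfg, program, read, next, isBit]
theorem step_header_comma : TM2.step program (cfg .header (Γ'.comma :: i) a b c r o) =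
    some (cfg .edges i a b c (r ++ [Γ'.comma]) o) := by
  simp [cfg, program, read, next, isBit]
theorem step_edges_bra : TM2.step program (cfg .edges (Γ'.bra :: i) a b c r o) =
    some (cfg .first i a b c (r ++ [Γ'.bra]) o) := by
  simp [cfg, program, read, next]
theorem step_edges_blank : TM2.step program (cfg .edges (Γ'.blank :: i) a b c r o) =
    some (cfg .tail i a b c (r ++ [Γ'.blank]) o) := by
  simp [cfg, program, read, next]
theorem step_first_bit (s : Bool) (x : Γ') :
    TM2.step program (cfg .first (Γ'.bit s :: i) (x :: a) b c r o) =
    some (cfg .first i a (Γ'.bit true :: b) c (r ++ rationalWord 0) o) := by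
  simp [cfg, program, read, next, isBit, move]
theorem step_first_comma (x : Γ') :
    TM2.step program (cfg .first (Γ'.comma :: i) (x :: a) b c r o) =
    some (cfg .second i a (Γ'.bit true :: b) c (r ++ rationalWord 1) o) := by
  simp [cfg, program, read, next, isBit, move]
theorem step_second_bit (s : Bool) :
    TM2.step program (cfg .second (Γ'.bit s :: i) a b c r o) = some (cfg .skip i a b c r o) := by
  simp [cfg, program, read, next, isBit]
theorem step_second_ket (x : Γ') :
    TM2.step program (cfg .second (Γ'.ket :: i) (x :: a) b c r o) =
    some (cfg .fill i a b (Γ'.bit true :: c) (r ++ rationalWord 1) o) := by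
  simp [cfg, program, read, next, isBit, move]
theorem step_skip_bit (s : Bool) : TM2.step program (cfg .skip i a (Γ'.bit s :: b) c r o) =
    some (cfg .second i a b (Γ'.bit true :: c) r o) := by
  simp [cfg, program, read, next, isBit]
theorem step_skip_nil (x : Γ') : TM2.step program (cfg .skip i (x :: a) [] c r o) =
    some (cfg .second i a [] (Γ'.bit true :: c) (r ++ rationalWord 0) o) := by
  simp [cfg, program, read, next, isBit, move]
theorem step_fill_bit (s : Bool) : TM2.step program (cfg .fill i (Γ'.bit s :: a) b c r o) =
    some (cfg .fill i a b (Γ'.bit true :: c) (r ++ rationalWord 0) o) := by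
  simp [cfg, program, read, next, isBit]
theorem step_fill_nil : TM2.step program (cfg .fill i [] b c r o) =
    some (cfg .restore i [] b c (r ++ [Γ'.ket]) o) := by
  simp [cfg, program, read, next, isBit]
theorem step_restore_bit (s : Bool) : TM2.step program (cfg .restore i a b (Γ'.bit s :: c) r o) =
    some (cfg .restore i (Γ'.bit true :: a) b c r o) := by
  simp [cfg, program, read, next, isBit]
theorem step_restore_nil : TM2.step program (cfg .restore i a b [] r o) =
    some (cfg .edges i a b [] r o) := by
  simp [cfg, program, read, next, isBit]
theorem step_tail_cons (x : Γ') : TM2.step program (cfg .tail (x :: i) a b c r o) =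
    some (cfg .tail i a b c (r ++ [x]) o) := by
  simp [cfg, program, read, next]
theorem step_tail_nil : TM2.step program (cfg .tail [] a b c r o) =
    some (cfg .clear [] a b c r o) := by
  simp [cfg, program, read, next]
theorem step_clear_cons (x : Γ') : TM2.step program (cfg .clear i (x :: a) b c r o) =
    some (cfg .clear i a b c r o) := by
  simp [cfg, program, read, next]
theorem step_clear_nil : TM2.step program (cfg .clear i [] b c r o) =
    some (cfg .flush i [] b c r o) := by
  simp [cfg, program, read, next]
theorem step_flush_concat (x : Γ') : TM2.step program (cfg .flush i a b c (r ++ [x]) o) =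
    some (cfg .flush i a b c r (x :: o)) := by
  simp [cfg, program, read, next]
theorem step_flush_nil : TM2.step program (cfg .flush i a b c [] o) =
    some ⟨none, none, contents i a b c [] o⟩ := by
  simp [cfg, program, read]

end steps

/-! ### Runs of the phases of the program, with step counts -/

variable (i r : List Γ')

theorem runsIn_header (n m : ℕ) :
    RunsIn (n + 1) (cfg .header (unaryWord n ++ Γ'.comma :: i) (unaryWord m) [] [] r [])
      (cfg .edges i (unaryWord (n + m)) [] [] (r ++ (unaryWord n ++ [Γ'.comma])) []) := by
  induction n generalizing m r with
  | zero =>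
    rw [Nat.zero_add m]
    exact .step (step_header_comma ..)
  | succ n ih =>
    rw [unaryWord_succ, List.cons_append]
    refine .head (step_header_bit ..) ?_
    rw [Nat.add_right_comm n 1 m]
    simpa [← unaryWord_succ m, List.append_assoc, Nat.add_assoc] using ih (r ++ [Γ'.bit true]) (m + 1)

theorem runsIn_first (n p q : ℕ) :
    RunsIn (n + 1)
      (cfg .first (unaryWord n ++ Γ'.comma :: i) (unaryWord (n + 1 + p)) (unaryWord q) [] r [])
      (cfg .second i (unaryWord p) (unaryWord (n + 1 + q)) []
        (r ++ (zerosWord n ++ rationalWord 1)) []) := by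
  induction n generalizing q r with
  | zero =>
    rw [Nat.zero_add, Nat.add_comm 1 p, Nat.add_comm 1 q]
    exact .step (step_first_comma ..)
  | succ n ih =>
    rw [Nat.add_right_comm (n + 1) 1 p, unaryWord_succ (n + 1 + p), unaryWord_succ n, List.cons_append]
    refine .head (step_first_bit ..) ?_
    simpa [← unaryWord_succ, List.append_assoc, Nat.add_assoc, Nat.add_left_comm, zerosWord_succ,
      Nat.add_comm] using ih (r ++ rationalWord 0) (q + 1)

/-- Each unit costs two steps, one in `.second` and one in `.skip`; nothing is written while `done₁`
is nonempty. -/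
theorem runsIn_skip (a : List Γ') (n q : ℕ) :
    RunsIn (2 * n) (cfg .second (unaryWord n ++ i) a (unaryWord n) (unaryWord q) r [])
      (cfg .second i a [] (unaryWord (n + q)) r []) := by
  induction n generalizing q with
  | zero => rw [Nat.zero_add q]; exact .refl _
  | succ n ih =>
    refine .head (step_second_bit ..) (.head (step_skip_bit ..) ?_)
    rw [Nat.add_right_comm n 1 q]
    exact ih (q + 1)

theorem runsIn_second (n p q : ℕ) :
    RunsIn (2 * n + 1)
      (cfg .second (unaryWord n ++ Γ'.ket :: i) (unaryWord (n + 1 + p)) [] (unaryWord q) r [])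
      (cfg .fill i (unaryWord p) [] (unaryWord (n + 1 + q))
        (r ++ (zerosWord n ++ rationalWord 1)) []) := by
  induction n generalizing q r with
  | zero =>
    rw [Nat.zero_add, Nat.add_comm 1 p, Nat.add_comm 1 q]
    exact .step (step_second_ket ..)
  | succ n ih =>
    rw [Nat.add_right_comm (n + 1) 1 p, unaryWord_succ (n + 1 + p), unaryWord_succ n, List.cons_append]
    refine .head (t := 2 * n + 1 + 1) (step_second_bit ..) (.head (step_skip_nil ..) ?_)
    simpa [← unaryWord_succ, List.append_assoc, Nat.add_assoc, Nat.add_left_comm, zerosWord_succ,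
      Nat.add_comm] using ih (r ++ rationalWord 0) (q + 1)

theorem runsIn_fill (n q : ℕ) :
    RunsIn (n + 1) (cfg .fill i (unaryWord n) [] (unaryWord q) r [])
      (cfg .restore i [] [] (unaryWord (n + q)) (r ++ (zerosWord n ++ [Γ'.ket])) []) := by
  induction n generalizing q r with
  | zero => rw [Nat.zero_add q]; exact .step (step_fill_nil ..)
  | succ n ih =>
    rw [unaryWord_succ n]
    refine .head (step_fill_bit ..) ?_
    rw [Nat.add_right_comm n 1 q]
    simpa [← unaryWord_succ, List.append_assoc, zerosWord_succ, Nat.add_assoc]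
      using ih (r ++ rationalWord 0) (q + 1)

theorem runsIn_restore (n q : ℕ) :
    RunsIn (n + 1) (cfg .restore i (unaryWord q) [] (unaryWord n) r [])
      (cfg .edges i (unaryWord (n + q)) [] [] r []) := by
  induction n generalizing q with
  | zero => rw [Nat.zero_add q]; exact .step (step_restore_nil ..)
  | succ n ih =>
    refine .head (step_restore_bit ..) ?_
    rw [Nat.add_right_comm n 1 q]
    exact ih (q + 1)

theorem runsIn_tail (a w : List Γ') :
    RunsIn (w.length + 1) (cfg .tail w a [] [] r []) (cfg .clear [] a [] [] (r ++ w) []) := by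
  induction w generalizing r with
  | nil => rw [List.append_nil]; exact .step (step_tail_nil ..)
  | cons x w ih =>
    refine .head (step_tail_cons ..) ?_
    simpa using ih (r ++ [x])

theorem runsIn_clear (a : List Γ') :
    RunsIn (a.length + 1) (cfg .clear i a [] [] r []) (cfg .flush i [] [] [] r []) := by
  induction a with
  | nil => exact .step (step_clear_nil ..)
  | cons x w ih => exact .head (step_clear_cons ..) ih

theorem runsIn_flush (o : List Γ') :
    RunsIn (r.length + 1) (cfg .flush i [] [] [] r o)
      ⟨none, none, contents i [] [] [] [] (r ++ o)⟩ := by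
  induction r using List.reverseRecOn generalizing o with
  | nil => exact .step (step_flush_nil ..)
  | append_singleton r x ih =>
    rw [List.length_append]
    refine .head (step_flush_concat ..) ?_
    simpa using ih (x :: o)

theorem runsIn_edge {n : ℕ} (e : Fin n × Fin n) (h : e.1 < e.2) :
    ∃ t ≤ 5 * n + 5, RunsIn t (cfg .edges (edgeWord e ++ i) (unaryWord n) [] [] r [])
      (cfg .edges i (unaryWord n) [] [] (r ++ pointWord (edgePoint e)) []) := by
  rw [pointWord_edgePoint e h]
  obtain ⟨⟨a, ha⟩, ⟨b, hb⟩⟩ := e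
  -- Here d zeros lie between the two ones and s zeros follow them: j = i + d + 1 and n = j + s + 1.
  obtain ⟨d, rfl⟩ := Nat.exists_eq_add_of_lt (show a < b from h)
  obtain ⟨s, rfl⟩ := Nat.exists_eq_add_of_lt hb
  simp only [show a + d + 1 - a - 1 = d by omega,
    show a + d + 1 + s + 1 - (a + d + 1) - 1 = s by omega]
  have h₀ := RunsIn.step (step_edges_bra (unaryWord a ++ Γ'.comma :: (unaryWord (a + 1) ++
    (unaryWord d ++ Γ'.ket :: i))) (unaryWord (a + 1 + (d + 1 + s))) [] [] r [])
  have h₁ := h₀.trans (runsIn_first _ _ a (d + 1 + s) 0)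
  have h₂ := h₁.trans (runsIn_skip _ _ _ (a + 1) 0)
  have h₃ := h₂.trans (runsIn_second _ _ d s _)
  have h₄ := h₃.trans (runsIn_fill _ _ s _)
  have h₅ := h₄.trans (runsIn_restore _ _ _ 0)
  refine ⟨_, ?_, h₅.congr ?_ ?_⟩
  · omega
  · have e₁ : unaryWord (a + d + 1) = unaryWord (a + 1) ++ unaryWord d := by
      rw [Nat.add_right_comm]; exact List.replicate_add _ _ _
    rw [show a + 1 + (d + 1 + s) = a + d + 1 + s + 1 by omega]
    simp [edgeWord, e₁, List.append_assoc]
  · rw [show s + (d + 1 + (a + 1 + 0)) + 0 = a + d + 1 + s + 1 by omega]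
    simp [List.append_assoc]

theorem runsIn_edges {n : ℕ} (l : List (Fin n × Fin n)) (h : ∀ e ∈ l, e.1 < e.2) :
    ∃ t ≤ l.length * (5 * n + 5),
      RunsIn t (cfg .edges (l.flatMap edgeWord ++ i) (unaryWord n) [] [] r [])
        (cfg .edges i (unaryWord n) [] [] (r ++ l.flatMap fun e => pointWord (edgePoint e)) []) := by
  induction l generalizing r with
  | nil => exact ⟨0, Nat.zero_le _, by simpa using RunsIn.refl _⟩
  | cons e l ih =>
    obtain ⟨t₁, ht₁, h₁⟩ := runsIn_edge (l.flatMap edgeWord ++ i) r e (h e (by simp))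
    obtain ⟨t₂, ht₂, h₂⟩ := ih (r ++ pointWord (edgePoint e)) fun e he => h e (by simp [he])
    refine ⟨t₁ + t₂, ?_, ?_⟩
    · rw [List.length_cons, Nat.succ_mul]; omega
    · simpa [List.append_assoc] using h₁.trans h₂

theorem length_flatMap_pointWord {n : ℕ} (l : List (Fin n × Fin n)) (h : ∀ e ∈ l, e.1 < e.2) :
    (l.flatMap fun e => pointWord (edgePoint e)).length = l.length * (4 * n + 4) := by
  induction l with
  | nil => simp
  | cons e l ih =>
    rw [List.flatMap_cons, List.length_append, ih fun e he => h e (by simp [he]),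
      length_pointWord_edgePoint e (h e (by simp)), List.length_cons, Nat.succ_mul l.length, Nat.add_comm]

theorem length_le_length_flatMap_edgeWord {n : ℕ} (l : List (Fin n × Fin n)) :
    l.length ≤ (l.flatMap edgeWord).length := by
  induction l with
  | nil => simp
  | cons e l ih => simp [edgeWord]; omega

theorem length_unaryWord (n : ℕ) : (unaryWord n).length = n := by simp [unaryWord]

/-- The word of a graph with `n` vertices and edges `l`, followed by a number. -/
def inputWord {n : ℕ} (l : List (Fin n × Fin n)) (w : List Γ') : List Γ' :=
  unaryWord n ++ Γ'.comma :: l.flatMap edgeWord ++ Γ'.blank :: w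

/-- The word of the edge points in dimension `n`, followed by a number. -/
def outputWord {n : ℕ} (l : List (Fin n × Fin n)) (w : List Γ') : List Γ' :=
  unaryWord n ++ Γ'.comma :: (l.flatMap fun e => pointWord (edgePoint e)) ++ Γ'.blank :: w

/-- A bound for the running time. -/
noncomputable def timeBound : Polynomial ℕ := 9 * Polynomial.X ^ 2 + 13 * Polynomial.X + 13

theorem runsIn_program {n : ℕ} (l : List (Fin n × Fin n)) (h : ∀ e ∈ l, e.1 < e.2)
    (w : List Γ') : ∃ t ≤ timeBound.eval (inputWord l w).length,
      RunsIn t (cfg .header (inputWord l w) [] [] [] [] [])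
        ⟨none, none, contents [] [] [] [] [] (outputWord l w)⟩ := by
  have h₁ := runsIn_header (l.flatMap edgeWord ++ Γ'.blank :: w) [] n 0
  obtain ⟨t, ht, h₂⟩ := runsIn_edges (Γ'.blank :: w) ([] ++ (unaryWord n ++ [Γ'.comma])) l h
  have h₃ := (h₁.trans h₂).trans (.step (step_edges_blank ..))
  have h₄ := h₃.trans (runsIn_tail ..)
  have h₅ := h₄.trans (runsIn_clear ..)
  have h₆ := h₅.trans (runsIn_flush ..)
  refine ⟨_, ?_, h₆.congr ?_ ?_⟩
  -- The input length bounds n, the number of edges and the length of `w`. An edge costs at most 5n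
  -- + 5 steps to process and 4n + 4 to flush, whence the leading coefficient 9.
  · have hl := length_le_length_flatMap_edgeWord l
    have hL : (inputWord l w).length = n + (l.flatMap edgeWord).length + w.length + 2 := by
      simp [inputWord, length_unaryWord]; omega
    simp only [timeBound, Polynomial.eval_add, Polynomial.eval_mul, Polynomial.eval_pow,
      Polynomial.eval_X, Polynomial.eval_ofNat, hL, List.length_append, List.length_cons,
      List.length_nil, length_flatMap_pointWord l h, length_unaryWord]
    generalize (l.flatMap edgeWord).length = m at *
    have : l.length * (5 * n + 5) ≤ m * (5 * n + 5) := Nat.mul_le_mul_right _ hl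
    have : l.length * (4 * n + 4) ≤ m * (4 * n + 4) := Nat.mul_le_mul_right _ hl
    nlinarith [Nat.zero_le (m * n), Nat.zero_le (m * w.length), Nat.zero_le (n * w.length),
      Nat.zero_le (m * m), Nat.zero_le (n * n), Nat.zero_le (w.length * w.length)]
  · simp [inputWord, List.append_assoc, unaryWord]
  · simp [outputWord, List.append_assoc]

end ReductionMachine

/-! ### The map on instances -/

theorem mem_edgePairs {n : ℕ} {G : SimpleGraph (Fin n)} {e : Fin n × Fin n} :
    e ∈ edgePairs G ↔ e.1 < e.2 ∧ G.Adj e.1 e.2 := by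
  obtain ⟨a, b⟩ := e
  simp [edgePairs]

theorem nodup_edgePairs {n : ℕ} (G : SimpleGraph (Fin n)) : (edgePairs G).Nodup :=
  ((List.nodup_finRange n).product (List.nodup_finRange n)).filter _

theorem edgePoint_injOn {n : ℕ} {e f : Fin n × Fin n} (he : e.1 < e.2) (hf : f.1 < f.2)
    (h : edgePoint e = edgePoint f) : e = f := by
  have key : ∀ t, (t = e.1 ∨ t = e.2) ↔ (t = f.1 ∨ t = f.2) := fun t => by
    have := congrFun h t
    unfold edgePoint at this
    split_ifs at this <;> simp_all
  obtain ⟨a, b⟩ := e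
  obtain ⟨c, d⟩ := f
  have h₁ := key a
  have h₂ := key b
  have h₃ := key c
  have h₄ := key d
  simp only [Prod.mk.injEq] at *
  grind

/-- The `k`-means instance whose points are the edges of the graph. -/
noncomputable def edgeInstance (I : VertexCoverInstance) : KMeansInstance where
  d := I.n
  points := (edgePairs I.graph).map edgePoint
  nodup := (nodup_edgePairs _).map_on fun _ he _ hf h =>
    edgePoint_injOn (mem_edgePairs.1 he).1 (mem_edgePairs.1 hf).1 h
  k := I.k

theorem encode_edgeInstance (I : VertexCoverInstance) : (edgeInstance I).encode =
    ReductionMachine.outputWord (edgePairs I.graph) (binaryWord I.k) := by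
  simp [KMeansInstance.encode, edgeInstance, ReductionMachine.outputWord, List.flatMap_map]

namespace ReductionMachine

theorem initList_machine (w : List Computability.Γ') :
    Turing.initList machine w = cfg .header w [] [] [] [] [] := by
  refine congrArg (Turing.TM2.Cfg.mk _ _) (funext fun k => ?_)
  cases k <;> rfl

theorem haltList_machine (w : List Computability.Γ') :
    Turing.haltList machine w = ⟨none, none, contents [] [] [] [] [] w⟩ := by
  refine congrArg (Turing.TM2.Cfg.mk _ _) (funext fun k => ?_)
  cases k <;> rfl

/-- The words `u` and `u'` leave room for the relabelling of symbols by the input and output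
alphabets, here the identity. -/
theorem RunsIn.outputs {t : ℕ} {w w' u u' : List Computability.Γ'}
    (h : RunsIn t (cfg .header w [] [] [] [] []) ⟨none, none, contents [] [] [] [] [] w'⟩)
    (hu : u = w) (hu' : u' = w') :
    (flip bind machine.step)^[t] (some (Turing.initList machine u)) =
      some (Turing.haltList machine u') := by
  rw [initList_machine, haltList_machine, hu, hu']
  exact h

end ReductionMachine

theorem efficientlyComputable_edgeInstance : EfficientlyComputable edgeInstance := by
  refine ⟨{
    tm := ReductionMachine.machine
    inputAlphabet := Equiv.refl _
    outputAlphabet := Equiv.refl _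
    time := ReductionMachine.timeBound
    outputsFun := fun I => ?_ }⟩
  have h := ReductionMachine.runsIn_program (edgePairs I.graph)
    (fun e he => (mem_edgePairs.1 he).1) (binaryWord I.k)
  refine ⟨⟨h.choose, ?_⟩, h.choose_spec.1⟩
  exact h.choose_spec.2.outputs (List.map_id _) ((List.map_id _).trans (encode_edgeInstance I))

theorem ncard_edgeSet {n : ℕ} (G : SimpleGraph (Fin n)) :
    G.edgeSet.ncard = (edgePairs G).length := by
  classical
  rw [← List.toFinset_card_of_nodup (nodup_edgePairs G), ← Set.ncard_coe_finset]
  symm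
  refine Set.ncard_congr (fun e _ => s(e.1, e.2)) ?_ ?_ ?_
  · intro e he
    exact (mem_edgePairs.1 (List.mem_toFinset.1 he)).2
  · intro e f he hf h
    have he := (mem_edgePairs.1 (List.mem_toFinset.1 he)).1
    have hf := (mem_edgePairs.1 (List.mem_toFinset.1 hf)).1
    rcases Sym2.eq_iff.1 h with ⟨h₁, h₂⟩ | ⟨h₁, h₂⟩
    · exact Prod.ext h₁ h₂
    · exact absurd (he.trans (h₂ ▸ hf)) (h₁ ▸ lt_irrefl _)
  · intro z
    induction z with | _ a b
    intro h
    rcases lt_or_gt_of_ne h.ne with hab | hab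
    · exact ⟨(a, b), by simpa [mem_edgePairs] using ⟨hab, h⟩, rfl⟩
    · exact ⟨(b, a), by simpa [mem_edgePairs] using ⟨hab, h.symm⟩, Sym2.eq_swap⟩

/-! ### Endpoints -/

/-- Both sides count the symmetric difference of the two sets. -/
theorem sq_dist_of_indicator {ι : Type*} [Fintype ι] [DecidableEq ι] {x y : EuclideanSpace ℝ ι}
    {s t : Finset ι} (hx : ∀ i, x i = if i ∈ s then 1 else 0)
    (hy : ∀ i, y i = if i ∈ t then 1 else 0) :
    dist x y ^ 2 = s.card + t.card - 2 * ((s ∩ t).card : ℝ) := by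
  have h : ∀ i, dist (x i) (y i) ^ 2 =
      (if i ∈ s then (1 : ℝ) else 0) + (if i ∈ t then 1 else 0) -
        2 * (if i ∈ s ∩ t then 1 else 0) := fun i => by
    rw [hx, hy, Real.dist_eq, sq_abs]
    by_cases h₁ : i ∈ s <;> by_cases h₂ : i ∈ t <;> simp [h₁, h₂]
    norm_num
  rw [EuclideanSpace.dist_eq, Real.sq_sqrt (Finset.sum_nonneg fun _ _ => sq_nonneg _)]
  simp only [h, Finset.sum_sub_distrib, Finset.sum_add_distrib, ← Finset.mul_sum, Finset.sum_boole,
    Finset.filter_univ_mem]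

namespace VertexCoverInstance

variable (I : VertexCoverInstance)

/-- The edge that is represented by a point. -/
noncomputable def edge (i : Fin (edgeInstance I).points.length) : Fin I.n × Fin I.n :=
  (edgePairs I.graph).get (i.cast (List.length_map _))

/-- The endpoints of the edge that is represented by a point. -/
noncomputable def ends (i : Fin (edgeInstance I).points.length) : Finset (Fin I.n) :=
  {(I.edge i).1, (I.edge i).2}

theorem edge_spec (i) : (I.edge i).1 < (I.edge i).2 ∧ I.graph.Adj (I.edge i).1 (I.edge i).2 :=
  mem_edgePairs.1 (List.get_mem _ _)

theorem exists_edge {a b : Fin I.n} (h : I.graph.Adj a b) : ∃ i, I.ends i = {a, b} := by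
  wlog hab : a < b generalizing a b
  · rw [Finset.pair_comm]
    exact this h.symm (lt_of_le_of_ne (not_lt.1 hab) h.ne')
  obtain ⟨i, hi⟩ := List.get_of_mem (mem_edgePairs.2 ⟨hab, h⟩ : (a, b) ∈ edgePairs I.graph)
  refine ⟨i.cast (List.length_map _).symm, ?_⟩
  have : I.edge (i.cast (List.length_map _).symm) = (a, b) := hi
  rw [ends, this]

theorem edge_injective : Function.Injective I.edge := fun i j h => by
  have := (List.nodup_iff_injective_get.1 (nodup_edgePairs I.graph)) h
  exact Fin.cast_injective _ this

theorem card_ends (i) : (I.ends i).card = 2 := Finset.card_pair (I.edge_spec i).1.ne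

theorem ends_injective : Function.Injective I.ends := fun i j h => by
  have hi := (I.edge_spec i).1
  have hj := (I.edge_spec j).1
  apply I.edge_injective
  unfold ends at h
  generalize I.edge i = e at *
  generalize I.edge j = f at *
  apply edgePoint_injOn hi hj
  funext t
  have := congrArg (t ∈ ·) h
  simp only [Finset.mem_insert, Finset.mem_singleton, eq_iff_iff] at this
  simp [edgePoint, this]

theorem adj_of_mem_ends {i} {a b : Fin I.n} (ha : a ∈ I.ends i) (hb : b ∈ I.ends i)
    (h : a ≠ b) : I.graph.Adj a b := by
  have := (I.edge_spec i).2
  simp only [ends, Finset.mem_insert, Finset.mem_singleton] at ha hb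
  rcases ha with rfl | rfl <;> rcases hb with rfl | rfl
  exacts [absurd rfl h, this, this.symm, absurd rfl h]

theorem point_apply (i) (t : Fin I.n) :
    (edgeInstance I).point i t = if t ∈ I.ends i then 1 else 0 := by
  have : (edgeInstance I).points.get i = edgePoint (I.edge i) :=
    List.getElem_map _
  unfold KMeansInstance.point
  simp only [this, edgePoint, ends, Finset.mem_insert, Finset.mem_singleton]
  split_ifs <;> simp

theorem sq_dist_point (i j) : dist ((edgeInstance I).point i) ((edgeInstance I).point j) ^ 2 =
    4 - 2 * ((I.ends i ∩ I.ends j).card : ℝ) := by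
  refine (sq_dist_of_indicator (I.point_apply i) (I.point_apply j)).trans ?_
  rw [I.card_ends, I.card_ends]
  norm_num

end VertexCoverInstance

/-! ### Distances to means -/

/-- The vector from the mean to x is the average of the x - p y; expand its squared norm and
polarize each inner product. Only pairwise distances remain, so no mean has to be computed in
coordinates. -/
theorem sq_dist_mean {ι V : Type*} [NormedAddCommGroup V] [InnerProductSpace ℝ V]
    (p : ι → V) {F : Finset ι} (hF : F.Nonempty) (x : V) :
    dist x ((F.card : ℝ)⁻¹ • ∑ y ∈ F, p y) ^ 2 =
      (∑ y ∈ F, dist x (p y) ^ 2) / F.card -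
        (∑ y ∈ F, ∑ z ∈ F, dist (p y) (p z) ^ 2) / (2 * F.card ^ 2) := by
  have hs : (F.card : ℝ) ≠ 0 := Nat.cast_ne_zero.2 hF.card_pos.ne'
  have h₁ : x - (F.card : ℝ)⁻¹ • ∑ y ∈ F, p y = (F.card : ℝ)⁻¹ • ∑ y ∈ F, (x - p y) := by
    rw [Finset.sum_sub_distrib, smul_sub, Finset.sum_const, ← Nat.cast_smul_eq_nsmul ℝ,
      inv_smul_smul₀ hs]
  have h₂ : ‖∑ y ∈ F, (x - p y)‖ ^ 2 = F.card * (∑ y ∈ F, dist x (p y) ^ 2) -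
      (∑ y ∈ F, ∑ z ∈ F, dist (p y) (p z) ^ 2) / 2 := by
    rw [← real_inner_self_eq_norm_sq, sum_inner]
    have : ∀ y ∈ F, inner ℝ (x - p y) (∑ z ∈ F, (x - p z)) = (F.card * dist x (p y) ^ 2 +
        ∑ z ∈ F, dist x (p z) ^ 2 - ∑ z ∈ F, dist (p y) (p z) ^ 2) / 2 := fun y _ => by
      have h : ∀ z ∈ F, inner ℝ (x - p y) (x - p z) =
          (dist x (p y) ^ 2 + dist x (p z) ^ 2 - dist (p y) (p z) ^ 2) / 2 := fun z _ => by
        rw [dist_eq_norm, dist_eq_norm, dist_comm, dist_eq_norm,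
          show p z - p y = (x - p y) - (x - p z) by abel, norm_sub_sq_real (x - p y)]
        ring
      rw [inner_sum, Finset.sum_congr rfl h, ← Finset.sum_div, Finset.sum_sub_distrib,
        Finset.sum_add_distrib, Finset.sum_const, nsmul_eq_mul]
    rw [Finset.sum_congr rfl this, ← Finset.sum_div, Finset.sum_sub_distrib,
      Finset.sum_add_distrib, Finset.sum_const, nsmul_eq_mul, ← Finset.mul_sum]
    ring
  rw [dist_eq_norm, h₁, norm_smul, mul_pow, h₂, Real.norm_eq_abs, sq_abs]
  field_simp

theorem sum_sq_dist_mean {ι V : Type*} [NormedAddCommGroup V] [InnerProductSpace ℝ V]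
    (p : ι → V) {F : Finset ι} (hF : F.Nonempty) :
    ∑ x ∈ F, dist (p x) ((F.card : ℝ)⁻¹ • ∑ y ∈ F, p y) ^ 2 =
      (∑ y ∈ F, ∑ z ∈ F, dist (p y) (p z) ^ 2) / (2 * F.card) := by
  have hs : (F.card : ℝ) ≠ 0 := Nat.cast_ne_zero.2 hF.card_pos.ne'
  rw [Finset.sum_congr rfl fun x _ => sq_dist_mean p hF (p x), Finset.sum_sub_distrib,
    ← Finset.sum_div, Finset.sum_const, nsmul_eq_mul]
  field_simp
  ring

/-! ### Covering a family of edges -/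

section Cover

variable {ι V : Type*} [DecidableEq ι] [DecidableEq V]

/-- The members of `F` that are disjoint from `x`. -/
def disjointFrom (E : ι → Finset V) (F : Finset ι) (x : ι) : Finset ι :=
  F.filter fun y => Disjoint (E x) (E y)

/-- A star needs one vertex. Otherwise at most one edge of F meets all the others, so the average D
of the disjointness counts is at least 1/2. Both ends of an edge with the smallest count, plus one
end of each edge disjoint from it, form a cover of size at most 2 + D ≤ 1 + 3D. -/
theorem exists_cover_card_le {G : SimpleGraph V} (hG : G.CliqueFree 3) {E : ι → Finset V}
    (hE : ∀ i, (E i).card = 2) (hinj : Function.Injective E)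
    (hadj : ∀ i, ∀ a ∈ E i, ∀ b ∈ E i, a ≠ b → G.Adj a b) {F : Finset ι} (hF : F.Nonempty) :
    ∃ S : Finset V, (∀ x ∈ F, ∃ v ∈ S, v ∈ E x) ∧
      (S.card : ℝ) ≤ 1 + 3 * ((∑ x ∈ F, ((disjointFrom E F x).card : ℝ)) / F.card) := by
  by_cases hstar : ∃ v, ∀ x ∈ F, v ∈ E x
  · obtain ⟨v, hv⟩ := hstar
    refine ⟨{v}, fun x hx => ⟨v, by simp, hv x hx⟩, ?_⟩
    rw [Finset.card_singleton, Nat.cast_one, le_add_iff_nonneg_right]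
    positivity
  push Not at hstar
  -- Suppose x ≠ x' both meet all of F, and let u be a common end. Some edge y of F avoids u, so it
  -- meets x and x' in their other ends v and w, and u, v, w form a triangle.
  have huniq : ∀ x ∈ F, ∀ x' ∈ F, disjointFrom E F x = ∅ → disjointFrom E F x' = ∅ → x = x' := by
    intro x hx x' hx' h h'
    by_contra hne
    have hmeet : ∀ {x}, disjointFrom E F x = ∅ → ∀ y ∈ F, ∃ v ∈ E x, v ∈ E y := fun {x} h y hy =>
      Finset.not_disjoint_iff.1 fun hd => by
        have : y ∈ disjointFrom E F x := Finset.mem_filter.2 ⟨hy, hd⟩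
        simp [h] at this
    obtain ⟨u, hu, hu'⟩ := hmeet h x' hx'
    obtain ⟨y, hy, huy⟩ := hstar u
    obtain ⟨v, hv, hvy⟩ := hmeet h y hy
    obtain ⟨w, hw, hwy⟩ := hmeet h' y hy
    have huv : u ≠ v := fun e => huy (e ▸ hvy)
    have huw : u ≠ w := fun e => huy (e ▸ hwy)
    have hx₂ : E x = {u, v} := (Finset.eq_of_subset_of_card_le
      (by simp [Finset.insert_subset_iff, hu, hv]) (by rw [hE, Finset.card_pair huv])).symm
    have hx₂' : E x' = {u, w} := (Finset.eq_of_subset_of_card_le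
      (by simp [Finset.insert_subset_iff, hu', hw]) (by rw [hE, Finset.card_pair huw])).symm
    have hvw : v ≠ w := fun e => hne (hinj (by rw [hx₂, hx₂', e]))
    exact hG {u, v, w} (SimpleGraph.is3Clique_triple_iff.2
      ⟨hadj x u hu v hv huv, hadj x' u hu' w hw huw, hadj y v hvy w hwy hvw⟩)
  have hs : (0 : ℝ) < F.card := Nat.cast_pos.2 hF.card_pos
  -- A single edge would be a star.
  have htwo : 2 ≤ F.card := by
    by_contra hlt
    obtain ⟨x, rfl⟩ := Finset.card_eq_one.1 (show F.card = 1 by have := hF.card_pos; omega)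
    obtain ⟨v, hv⟩ := Finset.card_pos.1 (show 0 < (E x).card by rw [hE]; omega)
    obtain ⟨y, hy, h⟩ := hstar v
    exact h (Finset.mem_singleton.1 hy ▸ hv)
  have hsum : F.card ≤ ∑ x ∈ F, (disjointFrom E F x).card + 1 := by
    have h₁ : (F.filter fun x => disjointFrom E F x = ∅).card ≤ 1 := Finset.card_le_one.2
      fun x hx y hy => huniq x (Finset.mem_filter.1 hx).1 y (Finset.mem_filter.1 hy).1
        (Finset.mem_filter.1 hx).2 (Finset.mem_filter.1 hy).2
    have h₂ : (F.filter fun x => ¬ disjointFrom E F x = ∅).card ≤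
        ∑ x ∈ F, (disjointFrom E F x).card := by
      rw [Finset.card_filter]
      refine Finset.sum_le_sum fun x _ => ?_
      split_ifs with h
      · exact Nat.zero_le _
      · exact Finset.card_pos.2 (Finset.nonempty_iff_ne_empty.2 h)
    have := Finset.card_filter_add_card_filter_not (s := F) fun x => disjointFrom E F x = ∅
    omega
  -- All but one edge have count at least 1, so the average is at least (s - 1)/s ≥ 1/2 for s ≥ 2.
  have hhalf : (1 : ℝ) / 2 ≤ (∑ x ∈ F, ((disjointFrom E F x).card : ℝ)) / F.card := by
    rw [le_div_iff₀ hs]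
    have h₁ : (F.card : ℝ) ≤ ∑ x ∈ F, ((disjointFrom E F x).card : ℝ) + 1 := by exact_mod_cast hsum
    have h₂ : (2 : ℝ) ≤ F.card := by exact_mod_cast htwo
    linarith
  obtain ⟨x, hx, hmin⟩ := F.exists_min_image (fun x => (disjointFrom E F x).card) hF
  have havg : ((disjointFrom E F x).card : ℝ) ≤
      (∑ x ∈ F, ((disjointFrom E F x).card : ℝ)) / F.card := by
    rw [le_div_iff₀ hs, mul_comm, ← nsmul_eq_mul, ← Finset.sum_const]
    exact Finset.sum_le_sum fun y hy => by exact_mod_cast hmin y hy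
  have hne : ∀ y, (E y).Nonempty := fun y => Finset.card_pos.1 (by rw [hE]; omega)
  choose g hg using hne
  refine ⟨E x ∪ (disjointFrom E F x).image g, fun y hy => ?_, ?_⟩
  · by_cases hd : Disjoint (E x) (E y)
    · exact ⟨g y, Finset.mem_union_right _
        (Finset.mem_image_of_mem g (Finset.mem_filter.2 ⟨hy, hd⟩)), hg y⟩
    · obtain ⟨v, hv, hvy⟩ := Finset.not_disjoint_iff.1 hd
      exact ⟨v, Finset.mem_union_left _ hv, hvy⟩
  · have h₁ : (E x ∪ (disjointFrom E F x).image g).card ≤ 2 + (disjointFrom E F x).card :=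
      (Finset.card_union_le _ _).trans (by rw [hE]; exact Nat.add_le_add_left Finset.card_image_le 2)
    have h₂ : ((E x ∪ (disjointFrom E F x).image g).card : ℝ) ≤ 2 + (disjointFrom E F x).card := by
      exact_mod_cast h₁
    linarith

end Cover

/-! ### Refining a map to a surjection onto a given number of classes -/

/-- Choose a representative of each fiber of `g` and enlarge the set of representatives to a set B
of size k. Elements of B go to themselves, all others to the representative of their fiber. This
retraction onto B preserves `g`. -/
theorem exists_surjective_refinement {ι β : Type*} [Fintype ι] [DecidableEq ι] [DecidableEq β]
    (g : ι → β) {k : ℕ} (h₁ : (Finset.univ.image g).card ≤ k) (h₂ : k ≤ Fintype.card ι) :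
    ∃ h : ι → Fin k, Function.Surjective h ∧ ∀ i j, h i = h j → g i = g j := by
  rcases isEmpty_or_nonempty ι with hι | hι
  · obtain rfl : k = 0 := by simpa using h₂
    exact ⟨isEmptyElim, fun j => j.elim0, isEmptyElim⟩
  have hsec : ∀ b : β, b ∈ Finset.univ.image g → ∃ i, g i = b := by simp
  choose! σ hσ using hsec
  have hσ' : ∀ i, g (σ (g i)) = g i := fun i => hσ _ (Finset.mem_image_of_mem g (Finset.mem_univ i))
  obtain ⟨B, hAB, -, hB⟩ := Finset.exists_subsuperset_card_eq
    (Finset.subset_univ ((Finset.univ.image g).image σ))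
    (Finset.card_image_le.trans h₁) (by simpa using h₂)
  have hmem : ∀ i, σ (g i) ∈ B := fun i =>
    hAB (Finset.mem_image_of_mem σ (Finset.mem_image_of_mem g (Finset.mem_univ i)))
  let r : ι → B := fun i => if hi : i ∈ B then ⟨i, hi⟩ else ⟨σ (g i), hmem i⟩
  have hr : ∀ i, g (r i) = g i := fun i => by
    by_cases hi : i ∈ B
    · simp [r, hi]
    · simp [r, hi, hσ']
  let e : B ≃ Fin k := B.equivFinOfCardEq hB
  refine ⟨e ∘ r, e.surjective.comp fun b => ⟨b, by simp [r]⟩, fun i j hij => ?_⟩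
  rw [← hr i, ← hr j, e.injective hij]

/-! ### Clusters of edges -/

theorem KClustering.cluster_nonempty {K : KMeansInstance} (C : KClustering K) (j : Fin K.k) :
    (C.cluster j).Nonempty := by
  obtain ⟨i, hi⟩ := C.nonempty j
  exact ⟨i, by simp [KClustering.cluster, hi]⟩

theorem KClustering.sum_card_cluster {K : KMeansInstance} (C : KClustering K) :
    ∑ j, (C.cluster j).card = K.points.length := by
  exact (Finset.card_eq_sum_card_fiberwise (s := Finset.univ)
    fun i _ => Finset.mem_univ (C.assign i)).symm.trans (Finset.card_fin _)

namespace VertexCoverInstance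

variable (I : VertexCoverInstance)

/-- Two edges share 0, 1 or 2 ends, and 2 only if they are equal. The form with indicators can be
summed over a cluster. -/
theorem sq_dist_point_eq (i j) :
    dist ((edgeInstance I).point i) ((edgeInstance I).point j) ^ 2 =
      2 + 2 * (if Disjoint (I.ends i) (I.ends j) then 1 else 0) - 2 * (if i = j then 1 else 0) := by
  rw [I.sq_dist_point]
  by_cases hij : i = j
  · subst hij
    have : ¬ Disjoint (I.ends i) (I.ends i) := fun h => by
      have := I.card_ends i
      simp_all
    rw [Finset.inter_self, I.card_ends, if_pos rfl, if_neg this]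
    norm_num
  rw [if_neg hij]
  split_ifs with hd
  · rw [Finset.disjoint_iff_inter_eq_empty.1 hd]
    norm_num
  · have h₁ : 0 < (I.ends i ∩ I.ends j).card := Finset.card_pos.2
      (Finset.nonempty_iff_ne_empty.2 fun h => hd (Finset.disjoint_iff_inter_eq_empty.2 h))
    have h₂ : (I.ends i ∩ I.ends j).card < 2 := by
      by_contra! hle
      refine hij (I.ends_injective (Eq.trans (b := I.ends i ∩ I.ends j) ?_ ?_))
      · exact (Finset.eq_of_subset_of_card_le Finset.inter_subset_left
          (by rwa [I.card_ends])).symm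
      · exact Finset.eq_of_subset_of_card_le Finset.inter_subset_right (by rwa [I.card_ends])
    rw [show (I.ends i ∩ I.ends j).card = 1 by omega]
    norm_num

variable {I} (F : Finset (Fin (edgeInstance I).points.length))

theorem sum_sq_dist_point (x) :
    ∑ y ∈ F, dist ((edgeInstance I).point x) ((edgeInstance I).point y) ^ 2 =
      2 * F.card + 2 * ((disjointFrom I.ends F x).card : ℝ) - 2 * (if x ∈ F then 1 else 0) := by
  rw [Finset.sum_congr rfl fun y _ => I.sq_dist_point_eq x y, Finset.sum_sub_distrib,
    Finset.sum_add_distrib, ← Finset.mul_sum, ← Finset.mul_sum, Finset.sum_const, nsmul_eq_mul,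
    Finset.sum_boole, Finset.sum_ite_eq, disjointFrom]
  ring

theorem sum_sum_sq_dist_point :
    ∑ x ∈ F, ∑ y ∈ F, dist ((edgeInstance I).point x) ((edgeInstance I).point y) ^ 2 =
      2 * F.card ^ 2 - 2 * F.card + 2 * ∑ x ∈ F, ((disjointFrom I.ends F x).card : ℝ) := by
  have : ∀ x ∈ F, ∑ y ∈ F, dist ((edgeInstance I).point x) ((edgeInstance I).point y) ^ 2 =
      2 * F.card - 2 + 2 * ((disjointFrom I.ends F x).card : ℝ) := fun x hx => by
    rw [sum_sq_dist_point, if_pos hx]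
    ring
  rw [Finset.sum_congr rfl this, Finset.sum_add_distrib, Finset.sum_const, nsmul_eq_mul,
    ← Finset.mul_sum]
  ring

variable (C : KClustering (edgeInstance I)) (j : Fin (edgeInstance I).k)

/-- With s edges and total disjointness count T, the ordered pairs contribute 2s² - 2s + 2T, which
is divided by 2s. -/
theorem cost_cluster :
    ∑ x ∈ C.cluster j, dist ((edgeInstance I).point x) (C.mean j) ^ 2 = (C.cluster j).card - 1 +
      (∑ x ∈ C.cluster j, ((disjointFrom I.ends (C.cluster j) x).card : ℝ)) /
        (C.cluster j).card := by
  have hs : ((C.cluster j).card : ℝ) ≠ 0 := Nat.cast_ne_zero.2 (C.cluster_nonempty j).card_pos.ne'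
  unfold KClustering.mean
  rw [sum_sq_dist_mean _ (C.cluster_nonempty j), sum_sum_sq_dist_point]
  field_simp

theorem sum_card_cluster : ∑ j, ((C.cluster j).card : ℝ) = I.graph.edgeSet.ncard := by
  have h : I.graph.edgeSet.ncard = (edgeInstance I).points.length :=
    (ncard_edgeSet _).trans (List.length_map _).symm
  exact (Nat.cast_sum _ _).symm.trans (congrArg Nat.cast (C.sum_card_cluster.trans h.symm))

/-- The excess over m - k vanishes exactly when the edges in each cluster meet pairwise. -/
theorem cost_eq : C.cost = I.graph.edgeSet.ncard - I.k +
    ∑ j, (∑ x ∈ C.cluster j, ((disjointFrom I.ends (C.cluster j) x).card : ℝ)) /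
        (C.cluster j).card := by
  unfold KClustering.cost
  rw [Finset.sum_congr rfl fun j _ => cost_cluster C j, Finset.sum_add_distrib,
    Finset.sum_sub_distrib, sum_card_cluster, Finset.sum_const, Finset.card_univ, Fintype.card_fin,
    nsmul_eq_mul, mul_one]
  rfl

/-- A clustering of small cost gives a small vertex cover. -/
theorem exists_isVertexCover (hG : I.graph.CliqueFree 3) :
    ∃ S : Finset (Fin I.n), I.graph.IsVertexCover ↑S ∧
      (S.card : ℝ) ≤ I.k + 3 * (C.cost - (I.graph.edgeSet.ncard - I.k)) := by
  choose S hS hcard using fun j => exists_cover_card_le hG I.card_ends I.ends_injective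
    (fun _ _ ha _ hb h => I.adj_of_mem_ends ha hb h) (C.cluster_nonempty j)
  refine ⟨Finset.univ.biUnion S, ?_, ?_⟩
  · intro a b hab
    obtain ⟨i, hi⟩ := I.exists_edge hab
    obtain ⟨v, hv, hvi⟩ := hS (C.assign i) i (by simp [KClustering.cluster])
    have hv' : v ∈ (↑(Finset.univ.biUnion S) : Set (Fin I.n)) :=
      Finset.mem_biUnion.2 ⟨_, Finset.mem_univ _, hv⟩
    rw [hi, Finset.mem_insert, Finset.mem_singleton] at hvi
    rcases hvi with rfl | rfl
    exacts [Or.inl hv', Or.inr hv']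
  · have h₁ : ((Finset.univ.biUnion S).card : ℝ) ≤ ∑ j, ((S j).card : ℝ) := by
      exact_mod_cast Finset.card_biUnion_le
    refine h₁.trans ((Finset.sum_le_sum fun j _ => hcard j).trans_eq ?_)
    rw [Finset.sum_add_distrib, ← Finset.mul_sum, Finset.sum_const, Finset.card_univ,
      Fintype.card_fin, nsmul_eq_mul, mul_one, cost_eq, add_sub_cancel_left]
    rfl

/-- The edges that have an endpoint in common are at most as many as the degree of that vertex. -/
theorem card_le_ncard_neighborSet {v : Fin I.n} (h : ∀ x ∈ F, v ∈ I.ends x) :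
    F.card ≤ (I.graph.neighborSet v).ncard := by
  classical
  rw [← Finset.card_image_of_injective F I.ends_injective, Set.ncard_eq_toFinset_card']
  refine (Finset.card_le_card (t := (I.graph.neighborSet v).toFinset.image fun w => {v, w})
    fun s hs => ?_).trans Finset.card_image_le
  obtain ⟨x, hx, rfl⟩ := Finset.mem_image.1 hs
  obtain ⟨w, hw, hwv⟩ := Finset.exists_mem_ne (by rw [I.card_ends x]; omega) v
  refine Finset.mem_image.2 ⟨w, ?_, ?_⟩
  · simpa using I.adj_of_mem_ends (h x hx) hw hwv.symm
  · exact Finset.eq_of_subset_of_card_le (by simp [Finset.insert_subset_iff, h x hx, hw])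
      (by rw [I.card_ends, Finset.card_pair hwv.symm])

/-- Distances to the center of a cluster whose edges meet pairwise. -/
theorem sq_dist_mean_of_disjointFrom_eq_empty
    (h : ∀ x ∈ C.cluster j, disjointFrom I.ends (C.cluster j) x = ∅) (x) :
    dist ((edgeInstance I).point x) (C.mean j) ^ 2 = 1 + 1 / (C.cluster j).card +
      2 * (disjointFrom I.ends (C.cluster j) x).card / (C.cluster j).card -
        2 * (if x ∈ C.cluster j then 1 else 0) / (C.cluster j).card := by
  have hs : ((C.cluster j).card : ℝ) ≠ 0 := Nat.cast_ne_zero.2 (C.cluster_nonempty j).card_pos.ne'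
  unfold KClustering.mean
  rw [sq_dist_mean _ (C.cluster_nonempty j), sum_sum_sq_dist_point, sum_sq_dist_point,
    Finset.sum_eq_zero (s := C.cluster j) fun x hx => by rw [h x hx]; simp]
  field_simp
  ring

/-- A small vertex cover gives a stable clustering of small cost. -/
theorem exists_clustering {Δ : ℕ} (hΔ : ∀ v, (I.graph.neighborSet v).ncard ≤ Δ)
    {S : Finset (Fin I.n)} (hS : I.graph.IsVertexCover ↑S) (hcard : S.card ≤ I.k)
    (hk : I.k ≤ I.graph.edgeSet.ncard) :
    ∃ C : KClustering (edgeInstance I), C.CenterProximal √(1 + 1 / ((Δ : ℝ) + 1)) ∧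
      C.Balanced (1 / ((Δ : ℝ) + 1)) ∧ C.cost ≤ (I.graph.edgeSet.ncard : ℝ) - I.k := by
  have hg : ∀ i, ∃ v ∈ S, v ∈ I.ends i := fun i => by
    rcases hS (I.edge_spec i).2 with h | h
    exacts [⟨_, h, by simp [ends]⟩, ⟨_, h, by simp [ends]⟩]
  choose g hgS hg using hg
  have hlen : I.graph.edgeSet.ncard = (edgeInstance I).points.length :=
    (ncard_edgeSet _).trans (List.length_map _).symm
  -- Grouping by `g` may give fewer than k stars; splitting stars yields smaller stars, and k ≤ m
  -- leaves enough edges for k nonempty ones.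
  obtain ⟨a, ha, hag⟩ := exists_surjective_refinement g (k := I.k)
    ((Finset.card_le_card (Finset.image_subset_iff.2 fun i _ => hgS i)).trans hcard)
    (by rwa [Fintype.card_fin, ← hlen])
  let C : KClustering (edgeInstance I) := ⟨a, ha⟩
  have hC : ∀ j, ∀ x ∈ C.cluster j, ∀ y ∈ C.cluster j, g x = g y := fun j x hx y hy =>
    hag x y (((Finset.mem_filter.1 hx).2).trans (Finset.mem_filter.1 hy).2.symm)
  have hmeet : ∀ j, ∀ x ∈ C.cluster j, disjointFrom I.ends (C.cluster j) x = ∅ := fun j x hx =>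
    Finset.filter_eq_empty_iff.2 fun y hy =>
      Finset.not_disjoint_iff.2 ⟨g x, hg x, hC j x hx y hy ▸ hg y⟩
  have hpos : ∀ j, (0 : ℝ) < (C.cluster j).card := fun j =>
    Nat.cast_pos.2 (C.cluster_nonempty j).card_pos
  -- The degree bound gives Δ; the weaker Δ + 1 keeps the constants meaningful when Δ = 0.
  have hsize : ∀ j, ((C.cluster j).card : ℝ) ≤ Δ + 1 := fun j => by
    obtain ⟨x, hx⟩ := C.cluster_nonempty j
    have := (card_le_ncard_neighborSet (C.cluster j) (v := g x)
      fun y hy => hC j x hx y hy ▸ hg y).trans (hΔ _)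
    exact_mod_cast this.trans (Nat.le_succ Δ)
  have hΔ₀ : (0 : ℝ) < (Δ : ℝ) + 1 := by positivity
  refine ⟨C, fun i j hij x hx => ?_, fun j => ?_, ?_⟩
  · have hxj : x ∉ C.cluster j := fun h =>
      hij ((Finset.mem_filter.1 hx).2.symm.trans (Finset.mem_filter.1 h).2)
    have h₁ := sq_dist_mean_of_disjointFrom_eq_empty C i (hmeet i) x
    have h₂ := sq_dist_mean_of_disjointFrom_eq_empty C j (hmeet j) x
    rw [hmeet i x hx, if_pos hx] at h₁
    rw [if_neg hxj, mul_zero, zero_div, sub_zero] at h₂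
    -- Compare squares: with s and s' the sizes of clusters i and j, α²(1 - 1/s) < α² = 1 + 1/(Δ +
    -- 1) ≤ 1 + 1/s'.
    refine lt_of_pow_lt_pow_left₀ 2 dist_nonneg ?_
    rw [mul_pow, Real.sq_sqrt (by positivity), h₁, h₂]
    have h₃ : 1 / ((Δ : ℝ) + 1) ≤ 1 / (C.cluster j).card :=
      one_div_le_one_div_of_le (hpos j) (hsize j)
    have h₄ : 0 ≤ 2 * ((disjointFrom I.ends (C.cluster j) x).card : ℝ) / (C.cluster j).card := by
      positivity
    have h₅ : 0 < 1 / ((C.cluster i).card : ℝ) := one_div_pos.2 (hpos i)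
    have h₆ : 0 < (1 + 1 / ((Δ : ℝ) + 1)) * (1 / ((C.cluster i).card : ℝ)) := by positivity
    calc (1 + 1 / ((Δ : ℝ) + 1)) * (1 + 1 / ((C.cluster i).card : ℝ) +
          2 * ((∅ : Finset (Fin (edgeInstance I).points.length)).card : ℝ) / (C.cluster i).card -
            2 * 1 / (C.cluster i).card)
        = (1 + 1 / ((Δ : ℝ) + 1)) - (1 + 1 / ((Δ : ℝ) + 1)) * (1 / ((C.cluster i).card : ℝ)) := by
          rw [Finset.card_empty]; ring
      _ < 1 + 1 / ((Δ : ℝ) + 1) := by linarith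
      _ ≤ _ := by linarith
  · have hk₀ : (0 : ℝ) < (edgeInstance I).k := Nat.cast_pos.2 j.pos
    have h₁ : (1 : ℝ) ≤ (C.cluster j).card := by exact_mod_cast (C.cluster_nonempty j).card_pos
    refine le_trans ?_ h₁
    -- Since m ≤ k(Δ + 1), the required size ωm/k is at most 1, so nonempty clusters suffice.
    rw [div_le_one hk₀, one_div, inv_mul_le_iff₀ hΔ₀, ← C.sum_card_cluster, Nat.cast_sum]
    refine (Finset.sum_le_sum fun j _ => hsize j).trans_eq ?_
    rw [Finset.sum_const, Finset.card_univ, Fintype.card_fin, nsmul_eq_mul, mul_comm]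
  · rw [cost_eq, Finset.sum_eq_zero fun j _ => ?_, add_zero]
    rw [Finset.sum_eq_zero fun x hx => by rw [hmeet j x hx]; simp, zero_div]

end VertexCoverInstance

/-! ### The main theorem -/

theorem mainTheorem9 :
    ∃ c : ℝ, 0 < c ∧ ∀ Δ : ℕ, ∃ α ω : ℝ, 1 < α ∧ 0 < ω ∧
      ∃ f : VertexCoverInstance → KMeansInstance, EfficientlyComputable f ∧
        ∀ I : VertexCoverInstance, I.graph.CliqueFree 3 →
          (∀ v, (I.graph.neighborSet v).ncard ≤ Δ) →
          (f I).k = I.k ∧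
          ((∃ S : Finset (Fin I.n), I.graph.IsVertexCover ↑S ∧ S.card ≤ I.k) →
            I.k ≤ I.graph.edgeSet.ncard →
            ∃ C : KClustering (f I), C.CenterProximal α ∧ C.Balanced ω ∧
              C.cost ≤ (I.graph.edgeSet.ncard : ℝ) - I.k) ∧
          (∀ ε : ℝ, 0 < ε →
            (∀ S : Finset (Fin I.n), I.graph.IsVertexCover ↑S → (I.k : ℝ) * (1 + ε) ≤ S.card) →
            ∀ C : KClustering (f I), C.CenterProximal α → C.Balanced ω →
              (I.graph.edgeSet.ncard : ℝ) - (1 - c * ε) * I.k ≤ C.cost) := by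
  refine ⟨1 / 3, by norm_num, fun Δ => ⟨√(1 + 1 / ((Δ : ℝ) + 1)), 1 / ((Δ : ℝ) + 1), ?_,
    by positivity, edgeInstance, efficientlyComputable_edgeInstance,
    fun I hG hΔ => ⟨rfl, ?_, ?_⟩⟩⟩
  · rw [Real.lt_sqrt zero_le_one, one_pow, lt_add_iff_pos_right]
    positivity
  · rintro ⟨S, hS, hcard⟩ hk
    exact VertexCoverInstance.exists_clustering hΔ hS hcard hk
  · intro ε _ hcover C _ _
    obtain ⟨S, hS, hcard⟩ := VertexCoverInstance.exists_isVertexCover C hG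
    have := hcover S hS
    -- From k(1 + ε) ≤ |S| ≤ k + 3 (cost - (m - k)) follows cost ≥ m - k + εk/3, so c = 1/3.
    linarith
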